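/- Let $X$ be a separable real or complex Banach space which does not contain a copy of $c_0$, i.e. no linear subspace of $X$ is linearly homeomorphic to $c_0$. Let $(x_n)_{n\in\mathbb N}\subseteq X$ and $(x_n^*)_{n\in\mathbb N}\subseteq X^*$ form a Schauder frame for $X$, i.e. $x=\sum_{n=1}^\infty x_n^*(x)\,x_n$ with convergence of the partial sums in norm for every $x\in X$, and suppose that $x_n=0$ for at most finitely many $n$. Call a sequence $(y_n^*)_{n\in\mathbb N}\subseteq X^*$ an alternative dual of $(x_n)$ if $x=\sum_{n=1}^\infty y_n^*(x)\,x_n$, with convergence of the partial sums in norm, for every $x\in X$. Then the following statements are equivalent. (a) $(x_n)_{n\in\mathbb N}$ is an unconditional basis for $X$ plus at most finitely many elements; that is, there is a finite set $A\subseteq\mathbb N$ such that $(x_n)_{n\in\mathbb N\setminus A}$ is an unconditional basis for $X$ (there are $e_n^*\in X^*$, $n\notin A$, with $e_m^*(x_n)=\delta_{mn}$ for all $m,n\notin A$ and $x=\sum_{n\notin A}e_n^*(x)\,x_n$ unconditionally for every $x\in X$). (b) For every alternative dual $(y_n^*)$ of $(x_n)$ and every $x\in X$, the series $\sum_{n=1}^\infty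 y_n^*(x)\,x_n$ converges unconditionally to $x$. -/

import Mathlib

open Filter Topology
open scoped ZeroAtInfty

/-- `X` contains a topologically isomorphic copy of `c₀`: some linear subspace of `X` is linearly
homeomorphic to `c₀`, the space of scalar sequences tending to `0` with the sup norm
(continuous functions on the discrete space `ℕ` vanishing at infinity). -/
def ContainsCZero (𝕜 X : Type*) [RCLike 𝕜] [NormedAddCommGroup X] [NormedSpace 𝕜 X] : Prop :=
  ∃ Y : Submodule 𝕜 X, Nonempty (C₀(ℕ, 𝕜) ≃L[𝕜] Y)

/-- `y` is an alternative dual of `x`: for every `v`, the partial sums of `∑ y n v • x n`, taken in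
the given order, converge to `v` in norm. -/
def IsAlternativeDual {𝕜 X : Type*} [RCLike 𝕜] [NormedAddCommGroup X] [NormedSpace 𝕜 X]
    (x : ℕ → X) (y : ℕ → StrongDual 𝕜 X) : Prop :=
  ∀ v : X, Tendsto (fun N : ℕ => ∑ n ∈ Finset.range N, y n v • x n) atTop (𝓝 v)

/-- The pair `(x, x')` is a Schauder frame for `X`. -/
def IsSchauderFrame {𝕜 X : Type*} [RCLike 𝕜] [NormedAddCommGroup X] [NormedSpace 𝕜 X]
    (x : ℕ → X) (x' : ℕ → StrongDual 𝕜 X) : Prop :=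
  IsAlternativeDual x x'

/-- The family `e` is an unconditional basis for `X` (the order of the index set is irrelevant,
since the expansions converge unconditionally). -/
def IsUnconditionalBasis (𝕜 : Type*) {X ι : Type*} [RCLike 𝕜] [NormedAddCommGroup X]
    [NormedSpace 𝕜 X] (e : ι → X) : Prop :=
  ∃ b : UnconditionalSchauderBasis ι 𝕜 X, ∀ i, b i = e i

/-- The sequence `x` is an unconditional basis for `X` plus at most finitely many elements:
deleting the terms with index in some finite set leaves an unconditional basis. -/
def IsUnconditionalBasisPlusFinite (𝕜 : Type*) {X : Type*} [RCLike 𝕜] [NormedAddCommGroup X]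
    [NormedSpace 𝕜 X] (x : ℕ → X) : Prop :=
  ∃ A : Finset ℕ, IsUnconditionalBasis 𝕜 (fun n : {n : ℕ // n ∉ A} => x n)

/-! From (a) to (b): coordinate functionals of the basis, applied to the series of an alternative
dual, determine its coefficients off `A` as the basis coordinates of `v` minus a finite sum.

From (b) to (a): adding to `x'` a rank-one term built from a null coefficient sequence gives another
alternative dual, so (b) makes every convergent `∑ aₙ xₙ` unconditional. Suppose nonzero null
sequences live arbitrarily far out. Gliding humps yield successive blocks with tiny total sum but an
initial segment of norm at least `1 / 2`. Weighting the blocks by `c ∈ c₀` gives a convergent, hence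
unconditional series, so the weighted initial segments are summable too; by the Bessaga–Pełczyński
argument (`containsCZero_of_summable`) they produce a copy of `c₀`. Hence finitely many coordinates
determine every null sequence. Subtracting null sequences from `x'` kills the coordinates in a
minimal such set `A`, and what is left is biorthogonal to the `xₙ`, `n ∉ A`. -/

/-- **Rosenthal's disjointness lemma**, for matrices of nonnegative reals whose off-diagonal row
sums are bounded: some infinite principal submatrix has off-diagonal row sums at most `ε`. -/
theorem exists_injective_offDiag_sum_le {ε : ℝ} (hε : 0 < ε) (d : ℕ) (m : ℕ → ℕ → ℝ)
    (h0 : ∀ i j, 0 ≤ m i j)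
    (hm : ∀ i, ∀ F : Finset ℕ, i ∉ F → ∑ j ∈ F, m i j ≤ d * ε) :
    ∃ φ : ℕ → ℕ, Function.Injective φ ∧
      ∀ i, ∀ F : Finset ℕ, i ∉ F → ∑ j ∈ F, m (φ i) (φ j) ≤ ε := by
  induction d generalizing m with
  | zero =>
    refine ⟨id, Function.injective_id, fun i F hi => (hm i F hi).trans ?_⟩
    simpa using hε.le
  | succ d ih =>
    -- `Nat.pair` splits the indices into infinitely many infinite classes. Either one class works,
    -- or each class `p` has an index `k p` with off-diagonal mass above `ε` inside its own class;
    -- this mass misses every `k q`, so the bound on the submatrix along `k` drops by `ε`.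
    by_cases hp : ∃ p, ∀ i, ∀ F : Finset ℕ, i ∉ F →
        ∑ j ∈ F, m (Nat.pair p i) (Nat.pair p j) ≤ ε
    · obtain ⟨p, hp⟩ := hp
      exact ⟨Nat.pair p, fun a b hab => (Nat.pair_eq_pair.1 hab).2, hp⟩
    · push Not at hp
      choose i F hi hF using hp
      set k : ℕ → ℕ := fun p => Nat.pair p (i p) with hk
      have hkinj : Function.Injective k := fun a b hab => (Nat.pair_eq_pair.1 hab).1
      obtain ⟨φ, hφ, hφm⟩ := ih (fun p q => m (k p) (k q)) (fun _ _ => h0 _ _) (by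
        intro p G hp
        have hpinj : Function.Injective (Nat.pair p) :=
          fun a b hab => (Nat.pair_eq_pair.1 hab).2
        have hdisj : Disjoint (G.map ⟨k, hkinj⟩) ((F p).map ⟨Nat.pair p, hpinj⟩) := by
          rw [Finset.disjoint_left]
          simp only [Finset.mem_map, Function.Embedding.coeFn_mk]
          rintro _ ⟨q, hq, rfl⟩ ⟨j, -, hj⟩
          exact hp ((Nat.pair_eq_pair.1 hj).1 ▸ hq)
        have hnot : k p ∉ G.map ⟨k, hkinj⟩ ∪ (F p).map ⟨Nat.pair p, hpinj⟩ := by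
          simp only [Finset.mem_union, Finset.mem_map, Function.Embedding.coeFn_mk]
          rintro (⟨q, hq, hqp⟩ | ⟨j, hj, hjp⟩)
          · exact hp (hkinj hqp ▸ hq)
          · exact hi p ((Nat.pair_eq_pair.1 hjp).2 ▸ hj)
        have h := hm (k p) _ hnot
        rw [Finset.sum_union hdisj, Finset.sum_map, Finset.sum_map] at h
        simp only [Function.Embedding.coeFn_mk] at h
        have h' := hF p
        push_cast at h
        change ∑ j ∈ F p, m (k p) (Nat.pair p j) > ε at h'
        linarith)
      exact ⟨k ∘ φ, hkinj.comp hφ, hφm⟩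

/-! ### Copies of `c₀` from weakly unconditionally Cauchy series -/

section CZero

variable {𝕜 X : Type*} [RCLike 𝕜] [NormedAddCommGroup X] [NormedSpace 𝕜 X]

theorem ZeroAtInftyContinuousMap.norm_apply_le (c : C₀(ℕ, 𝕜)) (k : ℕ) : ‖c k‖ ≤ ‖c‖ := by
  rw [← norm_toBCF_eq_norm]
  exact c.toBCF.norm_coe_le_norm k

/-- Finite sums with coefficients in the unit ball of `ℓ∞` being bounded by `C`, finite sums with
coefficients bounded by `r` are bounded by `C * r`. -/
theorem norm_sum_smul_le_mul_of_bounded {v : ℕ → X} {C : ℝ}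
    (hv : ∀ (F : Finset ℕ) (c : ℕ → 𝕜), (∀ k, ‖c k‖ ≤ 1) → ‖∑ k ∈ F, c k • v k‖ ≤ C)
    (F : Finset ℕ) (c : ℕ → 𝕜) {r : ℝ} (hr : 0 ≤ r) (hc : ∀ k ∈ F, ‖c k‖ ≤ r) :
    ‖∑ k ∈ F, c k • v k‖ ≤ C * r := by
  classical
  rcases hr.eq_or_lt with rfl | hr
  · have : ∑ k ∈ F, c k • v k = 0 :=
      Finset.sum_eq_zero fun k hk => by simp [norm_le_zero_iff.1 (hc k hk)]
    simp [this]
  · have h := hv F (fun k => if k ∈ F then (r : 𝕜)⁻¹ * c k else 0) (fun k => by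
      split_ifs with hk
      · rw [norm_mul, norm_inv, RCLike.norm_ofReal, abs_of_pos hr, inv_mul_le_iff₀ hr, mul_one]
        exact hc k hk
      · simp)
    have h2 : ∑ k ∈ F, c k • v k =
        (r : 𝕜) • ∑ k ∈ F, (if k ∈ F then (r : 𝕜)⁻¹ * c k else 0) • v k := by
      rw [Finset.smul_sum]
      refine Finset.sum_congr rfl fun k hk => ?_
      rw [if_pos hk, smul_smul, mul_inv_cancel_left₀ (by exact_mod_cast hr.ne')]
    rw [h2, norm_smul, RCLike.norm_ofReal, abs_of_pos hr, mul_comm]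
    gcongr

theorem summable_smul_of_bounded [CompleteSpace X] {v : ℕ → X} {C : ℝ}
    (hv : ∀ (F : Finset ℕ) (c : ℕ → 𝕜), (∀ k, ‖c k‖ ≤ 1) → ‖∑ k ∈ F, c k • v k‖ ≤ C)
    {c : ℕ → 𝕜} (hc : Tendsto c cofinite (𝓝 0)) : Summable fun k => c k • v k := by
  have hC : 0 ≤ C := by simpa using hv ∅ 0 (by simp)
  rw [summable_iff_vanishing_norm]
  intro ε hε
  have hr : 0 < ε / (C + 1) := by positivity
  have hfin : {k | ¬ ‖c k‖ < ε / (C + 1)}.Finite := by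
    have := (tendsto_zero_iff_norm_tendsto_zero.1 hc).eventually (gt_mem_nhds hr)
    exact this
  refine ⟨hfin.toFinset, fun F hF => ?_⟩
  refine (norm_sum_smul_le_mul_of_bounded hv F c hr.le fun k hk => ?_).trans_lt ?_
  · by_contra hcon
    exact Finset.disjoint_left.1 hF hk (by simpa using (lt_of_not_ge hcon).le)
  · rw [mul_div_assoc', div_lt_iff₀ (by positivity)]
    nlinarith

/-- A weakly unconditionally Cauchy series whose terms are bounded away from `0` produces a copy
of `c₀`. -/
theorem containsCZero_of_bounded [CompleteSpace X] {v : ℕ → X} {C δ : ℝ} (hδ : 0 < δ)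
    (hvδ : ∀ k, δ ≤ ‖v k‖)
    (hv : ∀ (F : Finset ℕ) (c : ℕ → 𝕜), (∀ k, ‖c k‖ ≤ 1) → ‖∑ k ∈ F, c k • v k‖ ≤ C) :
    ContainsCZero 𝕜 X := by
  classical
  have hC : 0 ≤ C := by simpa using hv ∅ 0 (by simp)
  choose f hf1 hf2 using fun k => exists_dual_vector'' 𝕜 (v k)
  have hrow : ∀ i (F : Finset ℕ), ∑ j ∈ F, ‖f i (v j)‖ ≤ C := by
    intro i F
    choose s hs1 hs2 using fun j => RCLike.exists_norm_eq_mul_self (f i (v j))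
    have h := (f i).le_of_opNorm_le (hf1 i) (∑ j ∈ F, s j • v j)
    have h2 : f i (∑ j ∈ F, s j • v j) = ((∑ j ∈ F, ‖f i (v j)‖ : ℝ) : 𝕜) := by
      rw [map_sum]
      push_cast
      exact Finset.sum_congr rfl fun j _ => by rw [map_smul, smul_eq_mul, ← hs2]
    rw [h2, RCLike.norm_ofReal, abs_of_nonneg (Finset.sum_nonneg fun _ _ => norm_nonneg _),
      one_mul] at h
    exact h.trans (hv F s fun k => (hs1 k).le)
  obtain ⟨d, hd⟩ := exists_nat_ge (C / (δ / 2))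
  obtain ⟨φ, hφ, hoff⟩ := exists_injective_offDiag_sum_le (half_pos hδ) d
    (fun i j => ‖f i (v j)‖) (fun _ _ => norm_nonneg _)
    (fun i F _ => (hrow i F).trans ((div_le_iff₀ (half_pos hδ)).1 hd))
  set w : ℕ → X := fun k => v (φ k) with hw
  have hwb : ∀ (F : Finset ℕ) (c : ℕ → 𝕜), (∀ k, ‖c k‖ ≤ 1) → ‖∑ k ∈ F, c k • w k‖ ≤ C := by
    intro F c hc
    have h := hv (F.map ⟨φ, hφ⟩) (Function.extend φ c 0) (fun k => by
      by_cases hk : ∃ j, φ j = k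
      · obtain ⟨j, rfl⟩ := hk
        rw [hφ.extend_apply]
        exact hc j
      · rw [Function.extend_apply' _ _ _ hk]
        simp)
    rw [Finset.sum_map] at h
    simpa [hφ.extend_apply] using h
  have hsum : ∀ c : C₀(ℕ, 𝕜), Summable fun k => c k • w k := fun c =>
    summable_smul_of_bounded hwb (by
      have := c.zero_at_infty'
      rw [cocompact_eq_cofinite] at this
      exact this)
  let T₀ : C₀(ℕ, 𝕜) →ₗ[𝕜] X :=
    { toFun := fun c => ∑' k, c k • w k
      map_add' := fun c c' => by
        rw [← (hsum c).tsum_add (hsum c')]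
        simp [add_smul]
      map_smul' := fun r c => by
        rw [RingHom.id_apply, ← (hsum c).tsum_const_smul]
        simp [mul_smul] }
  let T : C₀(ℕ, 𝕜) →L[𝕜] X := T₀.mkContinuous C fun c =>
    le_of_tendsto (hsum c).hasSum.norm (Eventually.of_forall fun F =>
      norm_sum_smul_le_mul_of_bounded hwb F c (norm_nonneg c) fun k _ => c.norm_apply_le k)
  have hT : ∀ c, HasSum (fun k => c k • w k) (T c) := fun c => (hsum c).hasSum
  -- `f (φ j)` norms `w j` and nearly annihilates the other `w k`, so it reads off `c j` with error
  -- at most `δ / 2 * ‖c‖`; the supremum over `j` then absorbs this error.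
  have hlow : ∀ c j, δ * ‖c j‖ ≤ ‖T c‖ + δ / 2 * ‖c‖ := by
    intro c j
    have h1 : ‖f (φ j) (T c) - c j • f (φ j) (w j)‖ ≤ δ / 2 * ‖c‖ := by
      have ht : Tendsto (fun F : Finset ℕ =>
          ‖∑ k ∈ F, c k • f (φ j) (w k) - c j • f (φ j) (w j)‖) atTop
          (𝓝 ‖f (φ j) (T c) - c j • f (φ j) (w j)‖) := by
        have := (hT c).mapL (f (φ j))
        simp only [map_smul] at this
        exact (Tendsto.sub_const this _).norm
      refine le_of_tendsto ht ?_
      filter_upwards [eventually_ge_atTop {j}] with F hF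
      have hj : j ∈ F := hF (Finset.mem_singleton_self j)
      rw [← Finset.sum_erase_add _ _ hj, add_sub_cancel_right]
      calc ‖∑ k ∈ F.erase j, c k • f (φ j) (w k)‖
          ≤ ∑ k ∈ F.erase j, ‖f (φ j) (w k)‖ * ‖c‖ := by
            refine norm_sum_le_of_le _ fun k _ => ?_
            rw [norm_smul, mul_comm]
            gcongr
            exact c.norm_apply_le k
        _ ≤ δ / 2 * ‖c‖ := by
            rw [← Finset.sum_mul]
            gcongr
            exact hoff j _ (Finset.notMem_erase _ _)
    have h2 : ‖c j • f (φ j) (w j)‖ = ‖c j‖ * ‖w j‖ := by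
      rw [norm_smul, hw, hf2, RCLike.norm_ofReal, abs_of_nonneg (norm_nonneg _)]
    have h3 : ‖f (φ j) (T c)‖ ≤ ‖T c‖ := by
      simpa using (f (φ j)).le_of_opNorm_le (hf1 _) (T c)
    have h4 : ‖c j • f (φ j) (w j)‖ ≤
        ‖f (φ j) (T c)‖ + ‖f (φ j) (T c) - c j • f (φ j) (w j)‖ :=
      norm_le_norm_add_norm_sub _ _
    have h5 : δ * ‖c j‖ ≤ ‖c j‖ * ‖w j‖ := by
      rw [mul_comm]
      gcongr
      exact hvδ _
    linarith
  have hbound : ∀ c, ‖c‖ ≤ (2 / δ) * ‖T c‖ := by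
    intro c
    have h : ‖c‖ ≤ (‖T c‖ + δ / 2 * ‖c‖) / δ := by
      rw [← ZeroAtInftyContinuousMap.norm_toBCF_eq_norm]
      refine (BoundedContinuousFunction.norm_le (by positivity)).2 fun j => ?_
      rw [le_div_iff₀ hδ, mul_comm]
      exact hlow c j
    rw [le_div_iff₀ hδ] at h
    rw [div_mul_eq_mul_div, le_div_iff₀ hδ]
    linarith
  have hanti : AntilipschitzWith (2 / δ).toNNReal T :=
    AddMonoidHomClass.antilipschitz_of_bound T fun c => by
      rw [Real.coe_toNNReal _ (by positivity)]
      exact hbound c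
  exact ⟨_, ⟨T.equivRange hanti.injective (hanti.isClosed_range T.uniformContinuous)⟩⟩

/-- If `∑ cₖ vₖ` converges unconditionally for all `c ∈ c₀` and the `vₖ` are bounded away from `0`,
then the space contains a copy of `c₀`. -/
theorem containsCZero_of_summable [CompleteSpace X] {v : ℕ → X} {δ : ℝ} (hδ : 0 < δ)
    (hvδ : ∀ k, δ ≤ ‖v k‖)
    (hv : ∀ c : ℕ → 𝕜, Tendsto c atTop (𝓝 0) → Summable fun k => c k • v k) :
    ContainsCZero 𝕜 X := by
  classical
  let ev : ℕ → C₀(ℕ, 𝕜) →L[𝕜] 𝕜 := fun k =>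
    LinearMap.mkContinuous
      { toFun := fun c => c k
        map_add' := fun _ _ => rfl
        map_smul' := fun _ _ => rfl } 1 (fun c => by simpa using c.norm_apply_le k)
  let S : Finset ℕ → C₀(ℕ, 𝕜) →L[𝕜] X := fun F => ∑ k ∈ F, (ev k).smulRight (v k)
  have hS : ∀ F c, S F c = ∑ k ∈ F, c k • v k := fun F c => by
    simp [S, ev, _root_.sum_apply]
  -- Unconditional convergence bounds the finite sums pointwise in `c`; uniform boundedness makes
  -- the bound uniform.
  obtain ⟨C, hC⟩ : ∃ C, ∀ F, ‖S F‖ ≤ C := by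
    refine banach_steinhaus fun c => ?_
    have hc : Tendsto c atTop (𝓝 0) := by
      have := c.zero_at_infty'
      rw [cocompact_eq_cofinite, Nat.cofinite_eq_atTop] at this
      exact this
    obtain ⟨s, hs⟩ := summable_iff_vanishing_norm.1 (hv c hc) 1 one_pos
    refine ⟨∑ k ∈ s, ‖c k • v k‖ + 1, fun F => ?_⟩
    rw [hS, ← Finset.sum_inter_add_sum_sdiff F s]
    refine (norm_add_le _ _).trans (add_le_add ((norm_sum_le _ _).trans ?_)
      (hs _ Finset.sdiff_disjoint).le)
    exact Finset.sum_le_sum_of_subset_of_nonneg Finset.inter_subset_right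
      fun _ _ _ => norm_nonneg _
  refine containsCZero_of_bounded hδ hvδ (C := C) fun F c hc => ?_
  let e : C₀(ℕ, 𝕜) :=
    { toFun := fun k => if k ∈ F then c k else 0
      continuous_toFun := continuous_of_discreteTopology
      zero_at_infty' := by
        rw [cocompact_eq_cofinite]
        refine tendsto_const_nhds.congr' ?_
        filter_upwards [F.finite_toSet.compl_mem_cofinite] with k hk
        exact (if_neg (by simpa using hk)).symm }
  have he : ∀ k, e k = if k ∈ F then c k else 0 := fun _ => rfl
  have hle : ‖e‖ ≤ 1 := by
    rw [← ZeroAtInftyContinuousMap.norm_toBCF_eq_norm]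
    refine (BoundedContinuousFunction.norm_le zero_le_one).2 fun k => ?_
    change ‖e k‖ ≤ 1
    rw [he]
    split_ifs
    · exact hc k
    · simp
  have h := (S F).le_of_opNorm_le (hC F) e
  rw [hS] at h
  have h2 : ∑ k ∈ F, e k • v k = ∑ k ∈ F, c k • v k :=
    Finset.sum_congr rfl fun k hk => by rw [he, if_pos hk]
  rw [h2] at h
  have hC0 : 0 ≤ C := (norm_nonneg (S ∅)).trans (hC ∅)
  exact h.trans (mul_le_of_le_one_right hC0 hle)

end CZero

/-! ### Null coefficients, gliding humps and the extraction of a basis -/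

section Frames

variable {𝕜 X : Type*} [RCLike 𝕜] [NormedAddCommGroup X] [NormedSpace 𝕜 X]

/-- The scalar sequences `a` for which the series `∑ aₙ xₙ` converges, in order, to `0`. -/
def nullCoefficients (𝕜 : Type*) {X : Type*} [RCLike 𝕜] [NormedAddCommGroup X] [NormedSpace 𝕜 X]
    (x : ℕ → X) : Submodule 𝕜 (ℕ → 𝕜) where
  carrier := {a | Tendsto (fun N : ℕ => ∑ n ∈ Finset.range N, a n • x n) atTop (𝓝 0)}
  zero_mem' := by simp
  add_mem' := by
    intro a b ha hb
    have h := Tendsto.add ha hb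
    rw [add_zero] at h
    exact h.congr fun N => by simp [add_smul, Finset.sum_add_distrib]
  smul_mem' := by
    intro r a ha
    have h := Tendsto.const_smul ha r
    rw [smul_zero] at h
    exact h.congr fun N => by simp [mul_smul, Finset.smul_sum]

theorem mem_nullCoefficients {x : ℕ → X} {a : ℕ → 𝕜} :
    a ∈ nullCoefficients 𝕜 x ↔
      Tendsto (fun N : ℕ => ∑ n ∈ Finset.range N, a n • x n) atTop (𝓝 0) :=
  Iff.rfl

/-- Two coefficient sequences whose series converge to the same vector differ by a null sequence of
coefficients. -/
theorem sub_mem_nullCoefficients {x : ℕ → X} {a b : ℕ → 𝕜} {v : X}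
    (ha : Tendsto (fun N : ℕ => ∑ n ∈ Finset.range N, a n • x n) atTop (𝓝 v))
    (hb : Tendsto (fun N : ℕ => ∑ n ∈ Finset.range N, b n • x n) atTop (𝓝 v)) :
    a - b ∈ nullCoefficients 𝕜 x := by
  have h := ha.sub hb
  rw [sub_self] at h
  exact h.congr fun N => by simp [sub_smul, Finset.sum_sub_distrib]

theorem tendsto_sum_single (x : ℕ → X) (m : ℕ) :
    Tendsto (fun N : ℕ => ∑ n ∈ Finset.range N, (Pi.single m 1 : ℕ → 𝕜) n • x n) atTop
      (𝓝 (x m)) := by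
  refine tendsto_const_nhds.congr' ?_
  filter_upwards [eventually_gt_atTop m] with N hN
  rw [Finset.sum_eq_single m]
  · simp
  · intro n _ hn
    simp [hn]
  · intro h
    exact absurd (Finset.mem_range.2 hN) h

/-- If all alternative duals of a Schauder frame yield unconditionally convergent expansions, then
every convergent series `∑ aₙ xₙ` converges unconditionally. -/
theorem hasSum_of_tendsto_of_forall_alternativeDual {x : ℕ → X} {x' : ℕ → StrongDual 𝕜 X}
    (hframe : IsSchauderFrame x x')
    (h : ∀ y : ℕ → StrongDual 𝕜 X, IsAlternativeDual x y →
      ∀ v : X, HasSum (fun n : ℕ => y n v • x n) v)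
    {a : ℕ → 𝕜} {v : X}
    (ha : Tendsto (fun N : ℕ => ∑ n ∈ Finset.range N, a n • x n) atTop (𝓝 v)) :
    HasSum (fun n => a n • x n) v := by
  rcases subsingleton_or_nontrivial X with hX | hX
  · convert (hasSum_zero : HasSum (fun _ : ℕ => (0 : X)) 0) using 1
  obtain ⟨u, hu⟩ := exists_ne (0 : X)
  obtain ⟨f, hf⟩ := SeparatingDual.exists_eq_one (R := 𝕜) hu
  have hz := sub_mem_nullCoefficients ha (hframe v)
  have hy : IsAlternativeDual x fun n => x' n + (a n - x' n v) • f := by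
    intro w
    have h1 := (hframe w).add (Tendsto.const_smul hz (f w))
    rw [smul_zero, add_zero] at h1
    refine h1.congr fun N => ?_
    rw [Finset.smul_sum, ← Finset.sum_add_distrib]
    refine Finset.sum_congr rfl fun n _ => ?_
    simp only [_root_.add_apply, _root_.smul_apply, Pi.sub_apply,
      smul_eq_mul, add_smul, mul_smul, smul_comm (f w)]
  -- At `u`, where `f u = 1`, the two duals differ exactly by `a n - x' n v`.
  have h2 := ((h _ hy u).sub (h _ hframe u)).add (h _ hframe v)
  rw [sub_self, zero_add] at h2
  convert h2 using 2 with n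
  simp [hf, ← add_smul, ← sub_smul]

/-- A nonzero sequence of null coefficients supported in the tail, suitably scaled, has an initial
segment with partial sums in the unit ball, one of norm at least `1 / 2`, and small total sum. -/
theorem exists_hump {x : ℕ → X} {M : ℕ} {a : ℕ → 𝕜} (ha : a ∈ nullCoefficients 𝕜 x) (ha0 : a ≠ 0)
    (haM : ∀ n < M, a n = 0) (hx : ∀ n, a n ≠ 0 → x n ≠ 0) {ε : ℝ} (hε : 0 < ε) :
    ∃ (b : ℕ → 𝕜) (m N : ℕ), m ≤ N ∧ M < N ∧
      (∀ L, ‖∑ n ∈ Finset.Ico M L, b n • x n‖ ≤ 1) ∧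
      1 / 2 ≤ ‖∑ n ∈ Finset.Ico M m, b n • x n‖ ∧
      ‖∑ n ∈ Finset.Ico M N, b n • x n‖ ≤ ε := by
  classical
  set S : ℕ → X := fun L => ∑ n ∈ Finset.range L, a n • x n with hS
  have hIco : ∀ L, ∑ n ∈ Finset.Ico M L, a n • x n = S L := by
    intro L
    refine Finset.sum_subset (fun n hn => ?_) fun n hn hn' => ?_
    · exact Finset.mem_range.2 (Finset.mem_Ico.1 hn).2
    · rw [haM n, zero_smul]
      by_contra hcon
      exact hn' (Finset.mem_Ico.2 ⟨not_lt.1 hcon, Finset.mem_range.1 hn⟩)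
  have hlim : Tendsto S atTop (𝓝 0) := ha
  have hbdd : BddAbove (Set.range fun L => ‖S L‖) := hlim.norm.bddAbove_range
  -- Dividing by the largest partial sum norm gives the unit bound; it is positive because the first
  -- nonzero term of `a` meets a nonzero `x n`.
  set s : ℝ := ⨆ L, ‖S L‖ with hs
  have hle : ∀ L, ‖S L‖ ≤ s := fun L => le_ciSup hbdd L
  have hspos : 0 < s := by
    by_contra hcon
    have hS0 : ∀ L, S L = 0 := fun L => norm_le_zero_iff.1 ((hle L).trans (not_lt.1 hcon))
    refine ha0 (funext fun n => ?_)
    by_contra hn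
    have h : a n • x n = 0 := by
      have h1 := hS0 (n + 1)
      rw [hS] at h1
      simp only [Finset.sum_range_succ] at h1
      have h2 : ∑ n ∈ Finset.range n, a n • x n = 0 := hS0 n
      rwa [h2, zero_add] at h1
    exact (smul_ne_zero hn (hx n hn)) h
  obtain ⟨m, hm⟩ := exists_lt_of_lt_ciSup (half_lt_self hspos)
  have hsmall : ∀ᶠ L in atTop, ‖S L‖ < s * ε :=
    (tendsto_zero_iff_norm_tendsto_zero.1 hlim).eventually (gt_mem_nhds (mul_pos hspos hε))
  obtain ⟨N, hN, hmN, hMN⟩ :=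
    (hsmall.and ((eventually_ge_atTop m).and (eventually_gt_atTop M))).exists
  have hb : ∀ L, ‖∑ n ∈ Finset.Ico M L, ((s : 𝕜)⁻¹ * a n) • x n‖ = ‖S L‖ / s := by
    intro L
    simp only [mul_smul]
    rw [← Finset.smul_sum, hIco, norm_smul, norm_inv, RCLike.norm_ofReal, abs_of_pos hspos,
      inv_mul_eq_div]
  refine ⟨fun n => (s : 𝕜)⁻¹ * a n, m, N, hmN, hMN, fun L => ?_, ?_, ?_⟩
  · rw [hb, div_le_one hspos]
    exact hle L
  · rw [hb, le_div_iff₀ hspos]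
    linarith
  · rw [hb, div_le_iff₀ hspos]
    linarith

/-- Gliding a hump: consecutive blocks of coefficients with partial sums in the unit ball and
summable block sums combine, with weights from `c₀`, to a convergent series. -/
theorem exists_tendsto_sum_of_blocks [CompleteSpace X] {x : ℕ → X} {M κ : ℕ → ℕ} (hM0 : M 0 = 0)
    (hM : StrictMono M) (hκ : ∀ k, ∀ n ∈ Set.Ico (M k) (M (k + 1)), κ n = k)
    {α : ℕ → ℕ → 𝕜}
    (hα : ∀ k L, ‖∑ n ∈ Finset.Ico (M k) L, α k n • x n‖ ≤ 1)
    (hα' : ∀ k, ‖∑ n ∈ Finset.Ico (M k) (M (k + 1)), α k n • x n‖ ≤ (1 / 2) ^ k)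
    {c : ℕ → 𝕜} (hc : Tendsto c atTop (𝓝 0)) :
    ∃ v, Tendsto (fun N : ℕ => ∑ n ∈ Finset.range N, (c (κ n) * α (κ n) n) • x n) atTop (𝓝 v) := by
  set b : ℕ → 𝕜 := fun n => c (κ n) * α (κ n) n with hb
  set t : ℕ → X := fun k => ∑ n ∈ Finset.Ico (M k) (M (k + 1)), α k n • x n with ht
  have hblock : ∀ k L, L ≤ M (k + 1) → ∑ n ∈ Finset.Ico (M k) L, b n • x n =
      c k • ∑ n ∈ Finset.Ico (M k) L, α k n • x n := by
    intro k L hL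
    rw [Finset.smul_sum]
    refine Finset.sum_congr rfl fun n hn => ?_
    have hn' := Finset.mem_Ico.1 hn
    rw [hb]
    simp only
    rw [hκ k n ⟨hn'.1, hn'.2.trans_le hL⟩, mul_smul]
  have hstart : ∀ k, ∑ n ∈ Finset.range (M k), b n • x n = ∑ j ∈ Finset.range k, c j • t j := by
    intro k
    induction k with
    | zero => simp [hM0]
    | succ k ih =>
      rw [Finset.sum_range_succ, ← ih, ← hblock k _ le_rfl,
        Finset.sum_range_add_sum_Ico _ (hM.monotone k.le_succ)]
  have hloc : ∀ n, ∃ k, n ∈ Set.Ico (M k) (M (k + 1)) := by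
    intro n
    have hex : ∃ k, n < M (k + 1) := ⟨n, (Nat.lt_succ_self n).trans_le (hM.id_le _)⟩
    classical
    refine ⟨Nat.find hex, ?_, Nat.find_spec hex⟩
    rcases hk : Nat.find hex with _ | j
    · simp [hM0]
    · exact not_lt.1 (Nat.find_min hex (hk ▸ j.lt_succ_self))
  have hκmem : ∀ n, n ∈ Set.Ico (M (κ n)) (M (κ n + 1)) := by
    intro n
    obtain ⟨k, hk⟩ := hloc n
    rwa [hκ k n hk]
  have hκlim : Tendsto κ atTop atTop := by
    refine tendsto_atTop.2 fun k => ?_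
    filter_upwards [eventually_ge_atTop (M k)] with n hn
    have := hn.trans_lt (hκmem n).2
    exact Nat.lt_succ_iff.1 (hM.lt_iff_lt.1 this)
  obtain ⟨B, hB⟩ := hc.norm.bddAbove_range
  have hBk : ∀ k, ‖c k‖ ≤ B := fun k => hB ⟨k, rfl⟩
  have hsum : Summable fun k => c k • t k := by
    refine Summable.of_norm_bounded
      ((summable_geometric_of_lt_one (by norm_num) (by norm_num : (1 / 2 : ℝ) < 1)).mul_left B)
      fun k => ?_
    rw [norm_smul]
    exact mul_le_mul (hBk k) (hα' k) (norm_nonneg _) ((norm_nonneg _).trans (hBk k))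
  refine ⟨∑' k, c k • t k, ?_⟩
  -- Completed blocks converge absolutely by the geometric bound; the unfinished block is controlled
  -- by `‖c (κ N)‖` alone.
  have h1 : Tendsto (fun N => ∑ j ∈ Finset.range (κ N), c j • t j) atTop
      (𝓝 (∑' k, c k • t k)) := hsum.hasSum.tendsto_sum_nat.comp hκlim
  have h2 : Tendsto (fun N => c (κ N) • ∑ n ∈ Finset.Ico (M (κ N)) N, α (κ N) n • x n) atTop
      (𝓝 0) := by
    refine squeeze_zero_norm (fun N => ?_)
      ((tendsto_zero_iff_norm_tendsto_zero.1 hc).comp hκlim)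
    rw [norm_smul]
    exact mul_le_of_le_one_right (norm_nonneg _) (hα _ _)
  have h3 := h1.add h2
  rw [add_zero] at h3
  refine h3.congr fun N => ?_
  rw [← hstart, ← hblock _ _ (hκmem N).2.le, Finset.sum_range_add_sum_Ico _ (hκmem N).1]

/-- An unconditionally convergent series may be summed over pairwise disjoint blocks. -/
theorem summable_sum_of_disjoint [CompleteSpace X] {g : ℕ → X} (hg : Summable g)
    {B : ℕ → Finset ℕ} (hB : Pairwise fun i j => Disjoint (B i) (B j)) :
    Summable fun k => ∑ n ∈ B k, g n := by
  let i : (Σ k, B k) → ℕ := fun p => p.2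
  have hi : Function.Injective i := by
    rintro ⟨k, n, hn⟩ ⟨l, m, hm⟩ (rfl : n = m)
    have hkl : k = l := by
      by_contra hkl
      exact Finset.disjoint_left.1 (hB hkl) hn hm
    subst hkl
    rfl
  have h := (hg.comp_injective hi).sigma
  refine h.congr fun k => ?_
  exact Finset.tsum_subtype (B k) g

/-- In a space without copies of `c₀`, if every convergent series `∑ aₙ xₙ` converges
unconditionally, then a tail of `x` admits no nontrivial expansion of `0`. -/
theorem exists_forall_nullCoefficients_eq_zero [CompleteSpace X] (hc : ¬ ContainsCZero 𝕜 X)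
    {x : ℕ → X} (hzero : {n : ℕ | x n = 0}.Finite)
    (hU : ∀ (a : ℕ → 𝕜) (v : X),
      Tendsto (fun N : ℕ => ∑ n ∈ Finset.range N, a n • x n) atTop (𝓝 v) →
        Summable fun n => a n • x n) :
    ∃ N : ℕ, ∀ a ∈ nullCoefficients 𝕜 x, (∀ n < N, a n = 0) → a = 0 := by
  by_contra hcon
  push Not at hcon
  obtain ⟨N₀, hN₀⟩ := hzero.bddAbove
  have hump : ∀ M k : ℕ, ∃ (b : ℕ → 𝕜) (m N : ℕ), m ≤ N ∧ M < N ∧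
      (∀ L, ‖∑ n ∈ Finset.Ico M L, b n • x n‖ ≤ 1) ∧
      1 / 2 ≤ ‖∑ n ∈ Finset.Ico M m, b n • x n‖ ∧
      ‖∑ n ∈ Finset.Ico M N, b n • x n‖ ≤ (1 / 2) ^ k := by
    intro M k
    -- Starting past `N₀` avoids all indices with `x n = 0`.
    obtain ⟨a, ha, haM, ha0⟩ := hcon (max M (N₀ + 1))
    refine exists_hump ha ha0 (fun n hn => haM n (lt_max_of_lt_left hn)) (fun n hn hx => hn ?_)
      (by positivity)
    exact haM n (lt_max_of_lt_right (Nat.lt_succ_of_le (hN₀ hx)))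
  choose b m N hmN hMN hb1 hb2 hb3 using hump
  let M : ℕ → ℕ := fun k => Nat.rec 0 (fun k Mk => N Mk k) k
  have hM : StrictMono M := strictMono_nat_of_lt_succ fun k => hMN (M k) k
  have hdisj : ∀ k l n, n ∈ Set.Ico (M k) (M (k + 1)) → n ∈ Set.Ico (M l) (M (l + 1)) → k = l := by
    intro k l n hk hl
    have h1 : k < l + 1 := hM.lt_iff_lt.1 (hk.1.trans_lt hl.2)
    have h2 : l < k + 1 := hM.lt_iff_lt.1 (hl.1.trans_lt hk.2)
    omega
  obtain ⟨κ, hκ⟩ : ∃ κ : ℕ → ℕ, ∀ k, ∀ n ∈ Set.Ico (M k) (M (k + 1)), κ n = k := by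
    classical
    refine ⟨fun n => if h : ∃ k, n ∈ Set.Ico (M k) (M (k + 1)) then h.choose else 0,
      fun k n hn => ?_⟩
    have h : ∃ k, n ∈ Set.Ico (M k) (M (k + 1)) := ⟨k, hn⟩
    simp only [dif_pos h]
    exact hdisj _ _ n h.choose_spec hn
  refine hc (containsCZero_of_summable (𝕜 := 𝕜) one_half_pos (fun k => hb2 (M k) k) ?_)
  intro c hc0
  obtain ⟨v, hv⟩ := exists_tendsto_sum_of_blocks (x := x) (α := fun k => b (M k) k) rfl hM hκ
    (fun k => hb1 (M k) k) (fun k => hb3 (M k) k) hc0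
  have hs := summable_sum_of_disjoint (hU _ v hv)
    (B := fun k => Finset.Ico (M k) (m (M k) k)) (by
      intro k l hkl
      rw [Finset.disjoint_left]
      intro n hk hl
      rw [Finset.mem_Ico] at hk hl
      exact hkl (hdisj k l n ⟨hk.1, hk.2.trans_le (hmN _ _)⟩ ⟨hl.1, hl.2.trans_le (hmN _ _)⟩))
  refine hs.congr fun k => ?_
  rw [Finset.smul_sum]
  refine Finset.sum_congr rfl fun n hn => ?_
  rw [Finset.mem_Ico] at hn
  rw [hκ k n ⟨hn.1, hn.2.trans_le (hmN _ _)⟩, mul_smul]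

/-- If finitely many coordinates determine the sequences of null coefficients, then some minimal
finite set of coordinates does, and there is a dual basis of null coefficients for it. -/
theorem exists_finset_dual_nullCoefficients {x : ℕ → X}
    (h : ∃ N : ℕ, ∀ a ∈ nullCoefficients 𝕜 x, (∀ n < N, a n = 0) → a = 0) :
    ∃ (A : Finset ℕ) (z : ℕ → ℕ → 𝕜),
      (∀ a ∈ nullCoefficients 𝕜 x, (∀ n ∈ A, a n = 0) → a = 0) ∧
      ∀ i ∈ A, z i ∈ nullCoefficients 𝕜 x ∧ z i i = 1 ∧ ∀ n ∈ A, n ≠ i → z i n = 0 := by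
  classical
  obtain ⟨N, hN⟩ := h
  obtain ⟨A, hA⟩ := exists_minimal_of_wellFoundedLT
    (fun A : Finset ℕ => ∀ a ∈ nullCoefficients 𝕜 x, (∀ n ∈ A, a n = 0) → a = 0)
    ⟨Finset.range N, fun a ha h => hN a ha fun n hn => h n (Finset.mem_range.2 hn)⟩
  have hz : ∀ i, ∃ z : ℕ → 𝕜, i ∈ A →
      z ∈ nullCoefficients 𝕜 x ∧ z i = 1 ∧ ∀ n ∈ A, n ≠ i → z n = 0 := by
    intro i
    by_cases hi : i ∈ A
    · have hnot := hA.not_prop_of_lt (Finset.erase_ssubset hi)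
      push Not at hnot
      obtain ⟨a, ha, haA, ha0⟩ := hnot
      have hai : a i ≠ 0 := fun hai => ha0 (hA.prop a ha fun n hn => by
        by_cases hni : n = i
        · rwa [hni]
        · exact haA n (Finset.mem_erase.2 ⟨hni, hn⟩))
      refine ⟨(a i)⁻¹ • a, fun _ => ⟨Submodule.smul_mem _ _ ha, ?_, fun n hn hni => ?_⟩⟩
      · simp [hai]
      · simp [haA n (Finset.mem_erase.2 ⟨hni, hn⟩)]
    · exact ⟨0, fun h => absurd h hi⟩
  choose z hz using hz
  exact ⟨A, z, hA.prop, hz⟩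

/-- If finitely many coordinates determine the sequences of null coefficients, and every alternative
dual converges unconditionally, then the frame is an unconditional basis plus finitely many
elements. -/
theorem isUnconditionalBasisPlusFinite_of_nullCoefficients {x : ℕ → X} {x' : ℕ → StrongDual 𝕜 X}
    (hframe : IsSchauderFrame x x')
    (hy : ∀ y : ℕ → StrongDual 𝕜 X, IsAlternativeDual x y →
      ∀ v : X, HasSum (fun n : ℕ => y n v • x n) v)
    (h : ∃ N : ℕ, ∀ a ∈ nullCoefficients 𝕜 x, (∀ n < N, a n = 0) → a = 0) :
    IsUnconditionalBasisPlusFinite 𝕜 x := by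
  classical
  obtain ⟨A, z, hA, hz⟩ := exists_finset_dual_nullCoefficients h
  let b : ℕ → StrongDual 𝕜 X := fun n => x' n - ∑ i ∈ A, z i n • x' i
  have hb : ∀ n v, b n v = x' n v - ∑ i ∈ A, x' i v * z i n := by
    intro n v
    simp [b, _root_.sub_apply, _root_.sum_apply, mul_comm]
  have hbA : ∀ n ∈ A, ∀ v, b n v = 0 := by
    intro n hn v
    rw [hb, Finset.sum_eq_single n, (hz n hn).2.1, mul_one, sub_self]
    · intro i hi hin
      rw [(hz i hi).2.2 n hn hin.symm, mul_zero]
    · exact fun h => absurd hn h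
  have hbdual : IsAlternativeDual x b := by
    intro v
    have hmem : ∑ i ∈ A, x' i v • z i ∈ nullCoefficients 𝕜 x :=
      Submodule.sum_mem _ fun i hi => Submodule.smul_mem _ _ (hz i hi).1
    have h1 := (hframe v).sub (mem_nullCoefficients.1 hmem)
    rw [sub_zero] at h1
    refine h1.congr fun N => ?_
    rw [← Finset.sum_sub_distrib]
    refine Finset.sum_congr rfl fun n _ => ?_
    rw [hb, sub_smul]
    simp
  refine ⟨A, ⟨⟨fun n => x n, fun n => b n, fun i j => ?_, fun v => ?_⟩, fun _ => rfl⟩⟩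
  -- Both `b · (x j)` and the unit sequence at `j` expand `x j` and vanish on `A`, so they coincide.
  · have h0 := hA _ (sub_mem_nullCoefficients (hbdual (x j)) (tendsto_sum_single x j))
      fun n hn => by
        have hnj : n ≠ j := fun hnj => j.2 (hnj ▸ hn)
        simp [hbA n hn, hnj]
    have h1 := congrFun h0 i
    rw [Pi.sub_apply, Pi.zero_apply, sub_eq_zero] at h1
    rw [h1]
    simp [Pi.single_apply, Subtype.ext_iff]
  · have h1 := hy b hbdual v
    have h2 : Function.support (fun n => b n v • x n) ⊆ {n | n ∉ A} := by
      intro n hn hnA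
      exact hn (by simp [hbA n hnA])
    exact (hasSum_subtype_iff_of_support_subset h2).2 h1

/-- For an unconditional basis plus finitely many elements, the expansions given by any alternative
dual converge unconditionally. -/
theorem IsUnconditionalBasisPlusFinite.hasSum {x : ℕ → X}
    (h : IsUnconditionalBasisPlusFinite 𝕜 x) {y : ℕ → StrongDual 𝕜 X}
    (hy : IsAlternativeDual x y) (v : X) : HasSum (fun n : ℕ => y n v • x n) v := by
  classical
  obtain ⟨A, e, he⟩ := h
  set w : X := v - ∑ n ∈ A, y n v • x n with hw
  have hcoord : ∀ i : {n : ℕ // n ∉ A}, e.coord i w = y i v := by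
    intro i
    have h1 := ((e.coord i).continuous.tendsto v).comp (hy v)
    have h2 : ∀ n ∉ A, e.coord i (x n) = if n = i then 1 else 0 := by
      intro n hn
      have := e.ortho i ⟨n, hn⟩
      rw [he] at this
      rw [this]
      simp [Pi.single_apply, Subtype.ext_iff, eq_comm]
    have h3 : Tendsto (fun N : ℕ => ∑ n ∈ Finset.range N, y n v * e.coord i (x n)) atTop
        (𝓝 (∑ n ∈ A, y n v * e.coord i (x n) + y i v)) := by
      refine tendsto_const_nhds.congr' ?_
      obtain ⟨N₀, hN₀⟩ := (insert (i : ℕ) A).bddAbove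
      filter_upwards [eventually_gt_atTop N₀] with N hN
      have hsub : insert (i : ℕ) A ⊆ Finset.range N := fun n hn =>
        Finset.mem_range.2 ((hN₀ hn).trans_lt hN)
      rw [← Finset.sum_subset hsub, Finset.sum_insert i.2, add_comm, h2 i i.2, if_pos rfl, mul_one]
      intro n _ hn
      rw [Finset.mem_insert, not_or] at hn
      rw [h2 n hn.2, if_neg hn.1, mul_zero]
    have h4 := tendsto_nhds_unique (h1.congr fun N => by simp) h3
    rw [hw, map_sub, map_sum, h4]
    simp
  have h1 : HasSum (fun i : {n : ℕ // n ∉ A} => y i v • x i) w := by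
    have := e.expansion w
    simpa only [hcoord, he] using this
  have h2 := (A.hasSum fun n => y n v • x n).add_compl h1
  simpa [hw] using h2

end Frames

theorem mainTheorem4 {𝕜 X : Type*} [RCLike 𝕜] [NormedAddCommGroup X] [NormedSpace 𝕜 X]
    [CompleteSpace X] [TopologicalSpace.SeparableSpace X]
    (hc : ¬ ContainsCZero 𝕜 X)
    (x : ℕ → X) (x' : ℕ → StrongDual 𝕜 X) (hframe : IsSchauderFrame x x')
    (hzero : {n : ℕ | x n = 0}.Finite) :
    IsUnconditionalBasisPlusFinite 𝕜 x ↔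
      ∀ y : ℕ → StrongDual 𝕜 X, IsAlternativeDual x y →
        ∀ v : X, HasSum (fun n : ℕ => y n v • x n) v := by
  refine ⟨fun h y hy v => h.hasSum hy v, fun h => ?_⟩
  exact isUnconditionalBasisPlusFinite_of_nullCoefficients hframe h
    (exists_forall_nullCoefficients_eq_zero hc hzero fun _ _ ha =>
      (hasSum_of_tendsto_of_forall_alternativeDual hframe h ha).summable)
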